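/- **Setting.** Let $\mu$ be a $\sigma$-finite measure on a measurable space, and let $X_1,X_2,\dots$ be random elements of that space with the following laws. Under $\mathsf P_\infty$ (no change), $X_n$ has conditional density $f_0(\cdot\mid X_1,\dots,X_{n-1})$ with respect to $\mu$ given $X_1,\dots,X_{n-1}$ (this density may depend on $n$). For $1\le \nu<\infty$, under $\mathsf P_\nu$ (change at time $\nu$), $X_n$ has conditional density $f_0(\cdot\mid X_1,\dots,X_{n-1})$ for $n<\nu$ and $f_{n,\nu}(\cdot\mid X_1,\dots,X_{n-1})$ for $n\ge\nu$. Let $\mathcal F_n=\sigma(X_1,\dots,X_n)$, with $\mathcal F_0$ trivial, let $\mathsf E_\nu$ be the expectation under $\mathsf P_\nu$ for $1\le\nu\le\infty$, and put $$Z_{n,\nu}=\log\frac{f_{n,\nu}(X_n\mid X_1,\dots,X_{n-1})}{f_0(X_n\mid X_1,\dots,X_{n-1})}\in[-\infty,\infty],\qquad n\ge\nu ,$$ with the conventions $0/0=0$, $a/0=\infty$ for $a>0$, $\log 0=-\infty$, $\log\infty=\infty$ and $(-\infty)+\infty=-\infty$. Stopping times are with respect to $(\mathcal F_n)_{n\ge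 0}$ and may take the value $\infty$. For a stopping time $\tau$ define the Lorden and Pollak delays $$\mathcal L(\tau)=\sup_{\nu\ge1}\operatorname{ess\,sup}\mathsf E_\nu[(\tau-\nu+1)^+\mid \mathcal F_{\nu-1}],\qquad \mathcal P(\tau)=\sup_{\nu\ge1,\ \mathsf P_\nu(\tau\ge\nu)>0}\mathsf E_\nu[\tau-\nu\mid\tau\ge\nu],$$ where $\nu$ ranges over finite change points and each essential supremum involving $\mathsf P_\nu$ or $\mathsf E_\nu$, here and below, is taken under $\mathsf P_\nu$ (a supremum over the empty set is $0$). Fix a real number $I>0$. **Theorem.** 1. Suppose that for every $\delta>0$ $$\lim_{n\to\infty}\ \sup_{\nu\ge1}\ \operatorname{ess\,sup}\ \mathsf P_\nu\Big(\max_{0\le t\le n}\sum_{i=\nu}^{\nu+t}Z_{i,\nu}\ge I(1+\delta)n\ \Big|\ \mathcal F_{\nu-1}\Big)=0 .$$ Then $\inf_\tau\mathcal L(\tau)\ge\inf_\tau\mathcal P(\tau)$ for every real $\gamma$, and as $\gamma\to\infty$ $$\inf_\tau\mathcal P(\tau)\ \ge\ \frac{\log\gamma}{I}(1+o(1)),$$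 the infima being over all stopping times $\tau$ with $\mathsf E_\infty[\tau]\ge\gamma$. 2. For every $\gamma>0$, the modified generalized CUSUM time $$\tau_{mc}=\min\Big\{n\ge1:\ \max_{1\le k\le n}\sum_{i=k}^nZ_{i,k}\ge\log\gamma\Big\}$$ (equal to $\infty$ if there is no such $n$) is a stopping time and satisfies $\mathsf E_\infty[\tau_{mc}]\ge\gamma$. 3. Suppose that for every $\delta>0$ $$\lim_{n\to\infty}\ \sup_{k\ge\nu\ge1}\ \operatorname{ess\,sup}\ \mathsf P_\nu\Big(\frac1n\sum_{i=k}^{k+n}Z_{i,k}\le I-\delta\ \Big|\ \mathcal F_{k-1}\Big)=0 .$$ Then, for $\tau_{mc}$ with threshold $\log\gamma$, one has $\mathcal P(\tau_{mc})\le\mathcal L(\tau_{mc})$ for every $\gamma>0$, and as $\gamma\to\infty$ $$\mathcal L(\tau_{mc})\ \le\ \frac{\log\gamma}{I}(1+o(1)).$$ In particular, if the conditions of parts 1 and 3 both hold with the same $I$, then $\tau_{mc}$ attains the lower bound of part 1 asymptotically for both delays. -/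

import Mathlib

open MeasureTheory ProbabilityTheory Filter Topology
open scoped ENNReal

noncomputable section

/-- Conditional densities, with respect to `μ`, of the observations `X_1, X_2, …`.
`pre n h x` is the pre-change density `f_0(x | h)` of `X_n` at `x`, given the history
`h = (X_1, …, X_{n-1})`, and `post ν n h x` is the post-change density `f_{n,ν}(x | h)` of `X_n`
when the change occurs at time `ν` (used for `n ≥ ν` only). -/
structure CondDensities {𝓧 : Type*} [MeasurableSpace 𝓧] (μ : Measure 𝓧) where
  pre : (n : ℕ) → (Finset.Ico 1 n → 𝓧) → 𝓧 → ℝ≥0∞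
  post : (ν n : ℕ) → (Finset.Ico 1 n → 𝓧) → 𝓧 → ℝ≥0∞
  measurable_pre : ∀ n, Measurable (Function.uncurry (pre n))
  measurable_post : ∀ ν n, Measurable (Function.uncurry (post ν n))
  lintegral_pre : ∀ n h, ∫⁻ x, pre n h x ∂μ = 1
  lintegral_post : ∀ ν n h, ∫⁻ x, post ν n h x ∂μ = 1

namespace CondDensities

variable {𝓧 : Type*} [MeasurableSpace 𝓧] {μ : Measure 𝓧}

/-- The conditional density of `X_n` given the history when the change occurs at
`ν ∈ {1, 2, …, ∞}`; for `ν = ∞` it is always the pre-change density. -/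
def at_change (f : CondDensities μ) (ν : ℕ∞) (n : ℕ) (h : Finset.Ico 1 n → 𝓧) (x : 𝓧) : ℝ≥0∞ :=
  if (n : ℕ∞) < ν then f.pre n h x else f.post ν.toNat n h x

/-- The joint density of `(X_1, …, X_n)` when the change occurs at `ν`: the product over
`i = 1, …, n` of the conditional densities of `X_i` given `(X_1, …, X_{i-1})`. -/
def joint (f : CondDensities μ) (ν : ℕ∞) (n : ℕ) (x : Finset.Icc 1 n → 𝓧) : ℝ≥0∞ :=
  ∏ i : Finset.Icc 1 n, f.at_change ν i
    (fun j => x ⟨j, Finset.mem_Icc.2 ⟨(Finset.mem_Ico.1 j.2).1,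
      (Finset.mem_Ico.1 j.2).2.le.trans (Finset.mem_Icc.1 i.2).2⟩⟩) (x i)

end CondDensities

section Model

variable {Ω 𝓧 : Type*} [mΩ : MeasurableSpace Ω] [MeasurableSpace 𝓧]

/-- The filtration `ℱ_n = σ(X_1, …, X_n)`; `ℱ_0` is trivial. -/
def obsFiltration (X : ℕ → Ω → 𝓧) (hX : ∀ n, Measurable (X n)) : Filtration ℕ mΩ where
  seq n := ⨆ i ∈ Finset.Icc 1 n, MeasurableSpace.comap (X i) inferInstance
  mono' _ _ hmn := biSup_mono fun _ hi => Finset.Icc_subset_Icc_right hmn hi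
  le' _ := iSup₂_le fun i _ => (hX i).comap_le

/-- `P ν`, for `1 ≤ ν ≤ ∞`, is a law of the data with change point `ν`: under `P ν`, for every `n`,
the vector `(X_1, …, X_n)` has the joint density built from the conditional densities `f`. -/
def IsChangePointFamily {μ : Measure 𝓧} [SigmaFinite μ] (f : CondDensities μ) (X : ℕ → Ω → 𝓧)
    (P : ℕ∞ → Measure Ω) : Prop :=
  ∀ ν : ℕ∞, 1 ≤ ν → ∀ n : ℕ,
    (P ν).map (fun ω (i : Finset.Icc 1 n) => X i ω) =
      (Measure.pi fun _ : Finset.Icc 1 n => μ).withDensity (f.joint ν n)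

/-- The log-likelihood ratio `Z_{n,ν} = log (f_{n,ν}(X_n | X_1, …, X_{n-1}) / f_0(X_n | X_1, …,
X_{n-1}))`, with values in `[-∞, ∞]`, so that densities may vanish. -/
def changeLLR {μ : Measure 𝓧} (f : CondDensities μ) (X : ℕ → Ω → 𝓧) (n ν : ℕ) (ω : Ω) : EReal :=
  ENNReal.log (f.post ν n (fun j => X j ω) (X n ω) / f.pre n (fun j => X j ω) (X n ω))

/-- `ess sup P_ν(A | ℱ_m)`, the essential supremum being taken under `P_ν`. -/
def essSupCondProb (ℱ : Filtration ℕ mΩ) (Pν : Measure Ω) (m : ℕ) (A : Set Ω) : ℝ≥0∞ :=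
  essSup (Pν⁻[A.indicator 1 | ℱ m]) Pν

/-- For all `δ > 0`, `sup_{ν ≥ 1} ess sup P_ν(max_{t ≤ n} ∑_{i=ν}^{ν+t} Z_{i,ν} ≥ I(1+δ)n |
X_1, …, X_{ν-1}) → 0` as `n → ∞`. -/
def UpperDeviationCondition (ℱ : Filtration ℕ mΩ) (P : ℕ∞ → Measure Ω)
    (Z : ℕ → ℕ → Ω → EReal) (I : ℝ) : Prop :=
  ∀ δ : ℝ, 0 < δ → Tendsto (fun n : ℕ => ⨆ (ν : ℕ) (_ : 1 ≤ ν),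
    essSupCondProb ℱ (P ν) (ν - 1)
      {ω | ((I * (1 + δ) * n : ℝ) : EReal) ≤
        (Finset.range (n + 1)).sup fun t => ∑ i ∈ Finset.Icc ν (ν + t), Z i ν ω})
    atTop (𝓝 0)

/-- For all `δ > 0`, `sup_{k ≥ ν ≥ 1} ess sup P_ν(n⁻¹ ∑_{i=k}^{k+n} Z_{i,k} ≤ I - δ |
X_1, …, X_{k-1}) → 0` as `n → ∞`. -/
def LowerDeviationCondition (ℱ : Filtration ℕ mΩ) (P : ℕ∞ → Measure Ω)
    (Z : ℕ → ℕ → Ω → EReal) (I : ℝ) : Prop :=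
  ∀ δ : ℝ, 0 < δ → Tendsto (fun n : ℕ => ⨆ (ν : ℕ) (_ : 1 ≤ ν) (k : ℕ) (_ : ν ≤ k),
    essSupCondProb ℱ (P ν) (k - 1)
      {ω | (∑ i ∈ Finset.Icc k (k + n), Z i k ω) / (n : EReal) ≤ ((I - δ : ℝ) : EReal)})
    atTop (𝓝 0)

/-- Mean time to false alarm `E_∞[τ]`, possibly infinite. -/
def meanFalseAlarm (P : ℕ∞ → Measure Ω) (τ : Ω → ℕ∞) : ℝ≥0∞ :=
  ∫⁻ ω, (τ ω : ℝ≥0∞) ∂(P ⊤)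

/-- Lorden's delay `sup_{ν ≥ 1} ess sup E_ν[(τ - ν + 1)^+ | X_1, …, X_{ν-1}]`. Subtraction in
`ℕ∞` is truncated at `0`, so `τ + 1 - ν` is the positive part. -/
def lordenDelay (ℱ : Filtration ℕ mΩ) (P : ℕ∞ → Measure Ω) (τ : Ω → ℕ∞) : ℝ≥0∞ :=
  ⨆ (ν : ℕ) (_ : 1 ≤ ν),
    essSup ((P ν)⁻[fun ω => ((τ ω + 1 - (ν : ℕ∞) : ℕ∞) : ℝ≥0∞) | ℱ (ν - 1)]) (P ν)

/-- Pollak's delay `sup_{ν ≥ 1} E_ν[τ - ν | τ ≥ ν]`; those `ν` for which `τ ≥ ν` has probability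
zero contribute `0`. -/
def pollakDelay (P : ℕ∞ → Measure Ω) (τ : Ω → ℕ∞) : ℝ≥0∞ :=
  ⨆ (ν : ℕ) (_ : 1 ≤ ν),
    ∫⁻ ω, ((τ ω - (ν : ℕ∞) : ℕ∞) : ℝ≥0∞) ∂((P ν)[|{ω | (ν : ℕ∞) ≤ τ ω}])

/-- The stopping times `τ` with `E_∞[τ] ≥ γ`. -/
def feasible (ℱ : Filtration ℕ mΩ) (P : ℕ∞ → Measure Ω) (γ : ℝ) : Set (Ω → ℕ∞) :=
  {τ | IsStoppingTime ℱ τ ∧ ENNReal.ofReal γ ≤ meanFalseAlarm P τ}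

/-- The modified generalized CUSUM time
`τ_mc = min {n ≥ 1 : max_{1 ≤ k ≤ n} ∑_{i=k}^n Z_{i,k} ≥ log γ}`, equal to `∞` if there is no
such `n`. -/
def modifiedCusum (Z : ℕ → ℕ → Ω → EReal) (γ : ℝ) (ω : Ω) : ℕ∞ :=
  ⨅ (n : ℕ) (_ : 1 ≤ n ∧ ((Real.log γ : ℝ) : EReal) ≤
    (Finset.Icc 1 n).sup fun k => ∑ i ∈ Finset.Icc k n, Z i k ω), (n : ℕ∞)

end Model

end

/-!
All three parts rest on one change of measure on `ℱ_n = σ(X_1, …, X_n)`. Let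
`Λ_{k,n} = exp (∑_{i=k}^n Z_{i,k})` be the likelihood ratio between a change at `k` and no change.
If `A ∈ ℱ_n` and `Λ_{k,n} ≥ c` on `A`, then `c P_∞(A) ≤ P_k(A)`; if `Λ_{k,n} < c < ∞` on `A`, then
`P_k(A) ≤ c P_∞(A)`. Vanishing densities do no harm: a zero pre-change density makes the ratio
infinite, unless the joint post-change density vanishes too. Moreover `P_k = P_∞` on `ℱ_{k-1}`.
Conditional expectations enter only through their essential suprema, and
`ess sup E[g | m] ≤ c` says exactly that `∫_B g ≤ c P(B)` for all `B ∈ m`.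

*False alarms.* On `{τ_mc = n}` some `Λ_{k,n}`, `k ≤ n`, is at least `γ`, so
`γ P_∞(τ_mc = n) ≤ ∑_{k ≤ n} P_k(τ_mc = n)`. Summing over `n` and exchanging the sums gives
`γ P_∞(τ_mc < ∞) ≤ ∑_k P_k(τ_mc ≥ k) = ∑_k P_∞(τ_mc ≥ k) = E_∞[τ_mc]`, since `{τ_mc ≥ k}` lies in
`ℱ_{k-1}` (`ofReal_mul_measure_modifiedCusum_ne_top_le`).

*Lower bound.* If `E_∞[τ] ≥ γ`, then for some `ν` the window `[ν, ν + m)` has conditional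
probability at most `2m / γ` given `τ ≥ ν` under `P_∞` (`exists_measure_window_le`). For `m`
slightly below `log γ / I` the log-likelihood ratio stays below a level slightly below `log γ` in this window
with `P_ν`-probability close to one, so by change of measure `τ` stops in the window with
`P_ν`-probability close to zero given `τ ≥ ν`, and the delay is about `m` (`mul_le_pollakDelay`).

*Upper bound.* After `ν`, cut time into blocks of length slightly more than `log γ / I`. Given the
past, each block ends without an alarm with probability at most `ε`, so the delay has a geometric
tail over the blocks and a conditional mean of at most one block length divided by `1 - ε`
(`lordenDelay_modifiedCusum_le`).
-/

/-! ### Conditional essential suprema in integrated form -/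

section CondLExp

variable {Ω : Type*} {m m0 : MeasurableSpace Ω} {P : Measure Ω} [IsFiniteMeasure P]

/-- An essential bound on a conditional expectation given `m` bounds the integrals over the
`m`-measurable sets. -/
lemma setLIntegral_le_of_essSup_condLExp (hm : m ≤ m0) (g : Ω → ℝ≥0∞) {B : Set Ω}
    (hB : MeasurableSet[m] B) :
    ∫⁻ ω in B, g ω ∂P ≤ essSup (P⁻[g | m]) P * P B := by
  rw [← setLIntegral_condLExp hm P g hB, ← setLIntegral_const]
  exact lintegral_mono_ae (ae_restrict_of_ae (ENNReal.ae_le_essSup _))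

/-- Conversely, a bound on the integrals over all `m`-measurable sets bounds the essential supremum
of the conditional expectation given `m`. -/
lemma essSup_condLExp_le (hm : m ≤ m0) (g : Ω → ℝ≥0∞) (c : ℝ≥0∞)
    (h : ∀ B, MeasurableSet[m] B → ∫⁻ ω in B, g ω ∂P ≤ c * P B) :
    essSup (P⁻[g | m]) P ≤ c := by
  refine essSup_le_of_ae_le c (ae_le_of_ae_le_trim (hm := hm) ?_)
  refine ae_le_of_forall_setLIntegral_le_of_sigmaFinite (μ := P.trim hm)
    (measurable_condLExp _ _ _) fun B hB _ => ?_
  rw [setLIntegral_condLExp_trim hm P g hB, setLIntegral_const, trim_measurableSet_eq hm hB]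
  exact h B hB

lemma measure_inter_le_of_essSup_condLExp (hm : m ≤ m0) {A B : Set Ω} (hA : MeasurableSet A)
    (hB : MeasurableSet[m] B) :
    P (B ∩ A) ≤ essSup (P⁻[A.indicator 1 | m]) P * P B := by
  have h := setLIntegral_le_of_essSup_condLExp (P := P) hm (A.indicator 1) hB
  rwa [lintegral_indicator_one hA, Measure.restrict_apply hA, Set.inter_comm] at h

end CondLExp

/-! ### Sums of tail probabilities -/

/-- The layer-cake formula for an extended natural number. -/
lemma ENat.toENNReal_eq_tsum (a : ℕ∞) :
    (a : ℝ≥0∞) = ∑' t : ℕ, if (t : ℕ∞) < a then (1 : ℝ≥0∞) else 0 := by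
  induction a using ENat.recTopCoe with
  | top => simp
  | coe n =>
    rw [tsum_eq_sum (s := Finset.range n) (by intro b hb; simpa using hb)]
    rw [Finset.sum_congr rfl (g := fun _ => (1 : ℝ≥0∞))
      (fun t ht => if_pos (by simpa using Finset.mem_range.1 ht))]
    simp

lemma setLIntegral_toENNReal_eq_tsum {Ω : Type*} [MeasurableSpace Ω] (P : Measure Ω)
    (B : Set Ω) (g : Ω → ℕ∞) (hg : ∀ t : ℕ, MeasurableSet {ω | (t : ℕ∞) < g ω}) :
    ∫⁻ ω in B, (g ω : ℝ≥0∞) ∂P = ∑' t : ℕ, P (B ∩ {ω | (t : ℕ∞) < g ω}) := by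
  have h : ∀ ω, (g ω : ℝ≥0∞) = ∑' t : ℕ, {ω | (t : ℕ∞) < g ω}.indicator 1 ω := fun ω => by
    rw [ENat.toENNReal_eq_tsum]
    exact tsum_congr fun t => by simp [Set.indicator_apply]
  simp_rw [h]
  rw [lintegral_tsum fun t => (measurable_one.indicator (hg t)).aemeasurable]
  refine tsum_congr fun t => ?_
  rw [lintegral_indicator_one (hg t), Measure.restrict_apply (hg t), Set.inter_comm]

/-- Grouping the terms of a series into blocks of length `N`. -/
lemma ENNReal.tsum_comp_div (N : ℕ) (hN : 0 < N) (g : ℕ → ℝ≥0∞) :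
    ∑' t : ℕ, g (t / N) = N * ∑' m : ℕ, g m := by
  have : NeZero N := ⟨hN.ne'⟩
  rw [← (Nat.divModEquiv N).symm.tsum_eq, ENNReal.tsum_prod', ← ENNReal.tsum_mul_left]
  refine tsum_congr fun m => ?_
  have h : ∀ r : Fin N, ((Nat.divModEquiv N).symm (m, r)) / N = m := fun r => by
    have := congrArg Prod.fst ((Nat.divModEquiv N).apply_symm_apply (m, r))
    simpa using this
  simp only [h, tsum_fintype, Finset.sum_const, Finset.card_univ, Fintype.card_fin, nsmul_eq_mul]

/-! ### Likelihood ratios and change of measure -/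

namespace CondDensities

variable {𝓧 : Type*} [MeasurableSpace 𝓧] {μ : Measure 𝓧}

/-- The observations strictly before time `i`, as part of the vector `(x_1, …, x_n)`. -/
def past {n : ℕ} (x : Finset.Icc 1 n → 𝓧) (i : Finset.Icc 1 n) : Finset.Ico 1 (i : ℕ) → 𝓧 :=
  fun j => x ⟨j, Finset.mem_Icc.2 ⟨(Finset.mem_Ico.1 j.2).1,
    (Finset.mem_Ico.1 j.2).2.le.trans (Finset.mem_Icc.1 i.2).2⟩⟩

/-- The likelihood ratio of `(x_1, …, x_n)` between a change at `k` and no change: the product over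
`k ≤ i ≤ n` of the ratios of post-change to pre-change conditional densities, in `[0, ∞]`. -/
noncomputable def likelihoodRatio (f : CondDensities μ) (k n : ℕ) (x : Finset.Icc 1 n → 𝓧) : ℝ≥0∞ :=
  ∏ i : Finset.Icc 1 n, if k ≤ i then f.post k i (past x i) (x i) / f.pre i (past x i) (x i) else 1

lemma measurable_past_apply {n : ℕ} (i : Finset.Icc 1 n) :
    Measurable fun x : Finset.Icc 1 n → 𝓧 => (past x i, x i) :=
  (measurable_pi_lambda _ fun _ => measurable_pi_apply _).prodMk (measurable_pi_apply _)

lemma measurable_likelihoodRatio (f : CondDensities μ) (k n : ℕ) :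
    Measurable (f.likelihoodRatio k n) := by
  refine Finset.measurable_fun_prod _ fun i _ => ?_
  split_ifs
  · exact ((f.measurable_post k i).comp (measurable_past_apply i)).div
      ((f.measurable_pre i).comp (measurable_past_apply i))
  · exact measurable_const

lemma joint_eq (f : CondDensities μ) (ν : ℕ∞) (n : ℕ) (x : Finset.Icc 1 n → 𝓧) :
    f.joint ν n x = ∏ i : Finset.Icc 1 n, f.at_change ν i (past x i) (x i) := rfl

lemma at_change_top (f : CondDensities μ) (n : ℕ) (h : Finset.Ico 1 n → 𝓧) (x : 𝓧) :
    f.at_change ⊤ n h x = f.pre n h x := by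
  simp [at_change]

lemma at_change_natCast (f : CondDensities μ) (k n : ℕ) (h : Finset.Ico 1 n → 𝓧) (x : 𝓧) :
    f.at_change k n h x = if k ≤ n then f.post k n h x else f.pre n h x := by
  by_cases hk : k ≤ n
  · simp [at_change, hk]
  · simp [at_change, hk, not_le.1 hk]

lemma joint_eq_joint_top (f : CondDensities μ) {k n : ℕ} (hkn : n < k) :
    f.joint k n = f.joint ⊤ n := by
  funext x
  simp only [joint_eq, at_change_top, at_change_natCast]
  refine Finset.prod_congr rfl fun i _ => if_neg ?_
  have := (Finset.mem_Icc.1 i.2).2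
  omega

lemma likelihoodRatio_mul_joint_top_le (f : CondDensities μ) (k n : ℕ)
    (x : Finset.Icc 1 n → 𝓧) :
    f.likelihoodRatio k n x * f.joint ⊤ n x ≤ f.joint k n x := by
  simp only [likelihoodRatio, joint_eq, at_change_top, at_change_natCast,
    ← Finset.prod_mul_distrib]
  refine Finset.prod_le_prod' fun i _ => ?_
  split_ifs
  · rw [mul_comm]
    exact ENNReal.mul_div_le
  · rw [one_mul]

/-- A density is infinite only on a null set, so almost every vector has finite pre-change
conditional densities. -/
lemma ae_pre_ne_top [SigmaFinite μ] (f : CondDensities μ) (n : ℕ) :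
    ∀ᵐ x ∂(Measure.pi fun _ : Finset.Icc 1 n => μ), ∀ i : Finset.Icc 1 n,
      f.pre i (past x i) (x i) ≠ ∞ := by
  rw [ae_all_iff]
  intro i
  let s : Set (Finset.Icc 1 n → 𝓧) := {x | f.pre i (past x i) (x i) = ∞}
  have hs : MeasurableSet s :=
    ((f.measurable_pre i).comp (measurable_past_apply i)) (measurableSet_singleton _)
  -- By Tonelli it suffices to integrate over the coordinate `x_i`, the past of `i` being fixed.
  have h0 : ∫⁻ x, s.indicator 1 x ∂(Measure.pi fun _ : Finset.Icc 1 n => μ) = 0 := by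
    rw [lintegral_eq_of_lmarginal_eq (μ := fun _ : Finset.Icc 1 n => μ) {i}
      (measurable_one.indicator hs) (measurable_const (a := (0 : ℝ≥0∞))) ?_, lintegral_zero]
    rw [lmarginal_singleton, lmarginal_singleton]
    funext x
    rw [lintegral_zero, lintegral_eq_zero_iff' ?_]
    · have h1 : ∀ᵐ y ∂μ, f.pre i (past x i) y < ∞ :=
        ae_lt_top ((f.measurable_pre i).comp measurable_prodMk_left)
          (by rw [f.lintegral_pre]; exact ENNReal.one_ne_top)
      filter_upwards [h1] with y hy
      have hpast : past (Function.update x i y) i = past x i := by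
        funext j
        refine Function.update_of_ne (fun h => ?_) _ _
        exact (Finset.mem_Ico.1 j.2).2.ne (congrArg Subtype.val h)
      refine Set.indicator_of_notMem (fun hmem => hy.ne ?_) _
      have h3 : f.pre i (past (Function.update x i y) i) (Function.update x i y i) = ∞ := hmem
      rwa [hpast, Function.update_self] at h3
    · exact ((measurable_one.indicator hs).comp (measurable_update x)).aemeasurable
  rw [lintegral_indicator_one hs] at h0
  rw [ae_iff]
  simpa [s] using h0

/-- Where all pre-change densities are finite, a likelihood ratio below a finite bound bounds the
joint post-change density, even if densities vanish. -/
lemma joint_le_of_likelihoodRatio_lt (f : CondDensities μ) {k n : ℕ} {c : ℝ≥0∞}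
    {x : Finset.Icc 1 n → 𝓧} (hx : ∀ i : Finset.Icc 1 n, f.pre i (past x i) (x i) ≠ ∞)
    (hc : f.likelihoodRatio k n x < c) : f.joint k n x ≤ c * f.joint ⊤ n x := by
  by_cases h0 : ∃ i : Finset.Icc 1 n, k ≤ i ∧ f.post k i (past x i) (x i) = 0
  · obtain ⟨i, hki, hi⟩ := h0
    rw [joint_eq, Finset.prod_eq_zero (Finset.mem_univ i)]
    · exact zero_le
    · rw [at_change_natCast, if_pos hki, hi]
  push Not at h0
  -- All factors of the likelihood ratio are positive, so an infinite factor makes it infinite.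
  have hpre : ∀ i : Finset.Icc 1 n, k ≤ i → f.pre i (past x i) (x i) ≠ 0 := by
    intro i hki hi
    refine (hc.trans_le le_top).ne ?_
    refine WithTop.prod_eq_top (i := i) (Finset.mem_univ _) ?_ ?_
    · rw [if_pos hki, hi]
      exact ENNReal.div_zero (h0 i hki)
    · intro j _
      split_ifs with hj
      · exact (ENNReal.div_pos (h0 j hj) (hx j)).ne'
      · exact (one_ne_zero : (1 : ℝ≥0∞) ≠ 0)
  calc f.joint k n x = f.likelihoodRatio k n x * f.joint ⊤ n x := by
        simp only [likelihoodRatio, joint_eq, at_change_top, at_change_natCast,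
          ← Finset.prod_mul_distrib]
        refine Finset.prod_congr rfl fun i _ => ?_
        split_ifs with hi
        · exact (ENNReal.div_mul_cancel (hpre i hi) (hx i)).symm
        · rw [one_mul]
    _ ≤ c * f.joint ⊤ n x := by gcongr

end CondDensities

section Model

variable {Ω 𝓧 : Type*} [MeasurableSpace 𝓧] {μ : Measure 𝓧} {f : CondDensities μ}
  {X : ℕ → Ω → 𝓧}

/-- The observed sum of log-likelihood ratios is the logarithm of a likelihood ratio; the
conventions for `±∞` in `EReal` and `ℝ≥0∞` agree. -/
lemma sum_changeLLR_eq_log (f : CondDensities μ) (X : ℕ → Ω → 𝓧) {k : ℕ} (hk : 1 ≤ k) (n : ℕ)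
    (ω : Ω) :
    ∑ i ∈ Finset.Icc k n, changeLLR f X i k ω =
      ENNReal.log (f.likelihoodRatio k n fun i => X i ω) := by
  have hlog : ∀ (s : Finset ℕ) (g : ℕ → ℝ≥0∞),
      ∑ i ∈ s, ENNReal.log (g i) = ENNReal.log (∏ i ∈ s, g i) := by
    intro s g
    induction s using Finset.cons_induction with
    | empty => simp
    | cons a s ha ih => rw [Finset.sum_cons, Finset.prod_cons, ENNReal.log_mul_add, ih]
  simp only [changeLLR]
  rw [hlog]
  congr 1
  have hfilter : Finset.Icc k n = (Finset.Icc 1 n).filter fun i => k ≤ i := by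
    ext i
    simp only [Finset.mem_Icc, Finset.mem_filter]
    omega
  rw [hfilter, Finset.prod_filter, ← Finset.prod_coe_sort]
  rfl

variable [mΩ : MeasurableSpace Ω] {P : ℕ∞ → Measure Ω}

lemma obsFiltration_eq_comap (hX : ∀ n, Measurable (X n)) (n : ℕ) :
    obsFiltration X hX n =
      MeasurableSpace.comap (fun ω (i : Finset.Icc 1 n) => X i ω) MeasurableSpace.pi := by
  simp only [MeasurableSpace.pi, MeasurableSpace.comap_iSup, MeasurableSpace.comap_comp]
  exact iSup_subtype'

lemma measurable_sum_changeLLR (f : CondDensities μ) (hX : ∀ n, Measurable (X n)) {k : ℕ}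
    (hk : 1 ≤ k) {m n : ℕ} (hmn : m ≤ n) :
    Measurable[obsFiltration X hX n] fun ω => ∑ i ∈ Finset.Icc k m, changeLLR f X i k ω := by
  have h : Measurable[obsFiltration X hX m]
      fun ω => ∑ i ∈ Finset.Icc k m, changeLLR f X i k ω := by
    simp_rw [sum_changeLLR_eq_log f X hk m]
    rw [obsFiltration_eq_comap hX]
    exact (f.measurable_likelihoodRatio k m).ennreal_log.comp (comap_measurable _)
  exact h.mono ((obsFiltration X hX).mono hmn) le_rfl

variable [SigmaFinite μ]

lemma IsChangePointFamily.measure_preimage (hP : IsChangePointFamily f X P)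
    (hX : ∀ n, Measurable (X n)) {ν : ℕ∞} (hν : 1 ≤ ν) {n : ℕ} {S : Set (Finset.Icc 1 n → 𝓧)}
    (hS : MeasurableSet S) :
    P ν ((fun ω (i : Finset.Icc 1 n) => X i ω) ⁻¹' S) =
      ∫⁻ x in S, f.joint ν n x ∂(Measure.pi fun _ : Finset.Icc 1 n => μ) := by
  rw [← withDensity_apply _ hS, ← hP ν hν n,
    Measure.map_apply (measurable_pi_lambda _ fun i : Finset.Icc 1 n => hX i) hS]

lemma IsChangePointFamily.isProbabilityMeasure (hP : IsChangePointFamily f X P)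
    (hX : ∀ n, Measurable (X n)) {ν : ℕ∞} (hν : 1 ≤ ν) : IsProbabilityMeasure (P ν) := by
  constructor
  -- The joint density of the empty vector is `1`.
  have h := hP.measure_preimage hX hν (n := 0) MeasurableSet.univ
  have : IsEmpty (Finset.Icc 1 0) := ⟨fun i => by simpa using i.2⟩
  rw [Set.preimage_univ] at h
  rw [h, Measure.restrict_univ, Measure.pi_of_empty (fun _ : Finset.Icc 1 0 => μ) isEmptyElim]
  simp [CondDensities.joint_eq]

/-- Before the change, the law of the observations is that without a change. -/
lemma IsChangePointFamily.measure_eq_top (hP : IsChangePointFamily f X P)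
    (hX : ∀ n, Measurable (X n)) {k n : ℕ} (hnk : n < k) {A : Set Ω}
    (hA : MeasurableSet[obsFiltration X hX n] A) : P k A = P ⊤ A := by
  rw [obsFiltration_eq_comap] at hA
  obtain ⟨S, hS, rfl⟩ := hA
  rw [hP.measure_preimage hX (ν := k) (by exact_mod_cast Nat.one_le_of_lt hnk) hS,
    hP.measure_preimage hX le_top hS, f.joint_eq_joint_top hnk]

/-- Change of measure where the likelihood ratio is at least `c`. -/
lemma IsChangePointFamily.mul_measure_top_le (hP : IsChangePointFamily f X P)
    (hX : ∀ n, Measurable (X n)) {k : ℕ} (hk : 1 ≤ k) {n : ℕ} {A : Set Ω}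
    (hA : MeasurableSet[obsFiltration X hX n] A) {c : ℝ≥0∞}
    (hc : ∀ ω ∈ A, ENNReal.log c ≤ ∑ i ∈ Finset.Icc k n, changeLLR f X i k ω) :
    c * P ⊤ A ≤ P k A := by
  rw [obsFiltration_eq_comap] at hA
  obtain ⟨S, hS, rfl⟩ := hA
  have hT : MeasurableSet (S ∩ {x | c ≤ f.likelihoodRatio k n x}) :=
    hS.inter (measurableSet_le measurable_const (f.measurable_likelihoodRatio k n))
  have hST : (fun ω (i : Finset.Icc 1 n) => X i ω) ⁻¹' S =
      (fun ω (i : Finset.Icc 1 n) => X i ω) ⁻¹' (S ∩ {x | c ≤ f.likelihoodRatio k n x}) := by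
    refine Set.Subset.antisymm (fun ω hω => ⟨hω, ?_⟩) (fun ω hω => hω.1)
    have := hc ω hω
    rwa [sum_changeLLR_eq_log f X hk, ENNReal.log_le_log_iff] at this
  rw [hST, hP.measure_preimage hX (ν := k) (by exact_mod_cast hk) hT,
    hP.measure_preimage hX le_top hT]
  refine (lintegral_const_mul_le _ _).trans (setLIntegral_mono' hT fun x hx => ?_)
  exact (mul_le_mul_left hx.2 _).trans (f.likelihoodRatio_mul_joint_top_le k n x)

/-- Change of measure where the likelihood ratio is less than `c`. -/
lemma IsChangePointFamily.measure_le_mul_top (hP : IsChangePointFamily f X P)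
    (hX : ∀ n, Measurable (X n)) {k : ℕ} (hk : 1 ≤ k) {n : ℕ} {A : Set Ω}
    (hA : MeasurableSet[obsFiltration X hX n] A) {c : ℝ≥0∞} (hc_top : c ≠ ∞)
    (hc : ∀ ω ∈ A, ∑ i ∈ Finset.Icc k n, changeLLR f X i k ω < ENNReal.log c) :
    P k A ≤ c * P ⊤ A := by
  rw [obsFiltration_eq_comap] at hA
  obtain ⟨S, hS, rfl⟩ := hA
  have hT : MeasurableSet (S ∩ {x | f.likelihoodRatio k n x < c}) :=
    hS.inter (measurableSet_lt (f.measurable_likelihoodRatio k n) measurable_const)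
  have hST : (fun ω (i : Finset.Icc 1 n) => X i ω) ⁻¹' S =
      (fun ω (i : Finset.Icc 1 n) => X i ω) ⁻¹' (S ∩ {x | f.likelihoodRatio k n x < c}) := by
    refine Set.Subset.antisymm (fun ω hω => ⟨hω, ?_⟩) (fun ω hω => hω.1)
    have := hc ω hω
    rwa [sum_changeLLR_eq_log f X hk, ENNReal.log_lt_log_iff] at this
  rw [hST, hP.measure_preimage hX (ν := k) (by exact_mod_cast hk) hT,
    hP.measure_preimage hX le_top hT,
    ← lintegral_const_mul' _ _ hc_top]
  refine setLIntegral_mono_ae' hT ?_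
  filter_upwards [f.ae_pre_ne_top n] with x hx hxT
  exact f.joint_le_of_likelihoodRatio_lt hx hxT.2

end Model

/-! ### Stopping times and delays -/

section StoppingTime

variable {Ω : Type*}

lemma disjoint_eq_natCast (τ : Ω → ℕ∞) :
    Pairwise (Function.onFun Disjoint fun n : ℕ => {ω | τ ω = n}) := by
  intro i j hij
  refine Set.disjoint_left.2 fun ω (hi : τ ω = i) (hj : τ ω = j) => hij ?_
  exact_mod_cast hi.symm.trans hj

variable [mΩ : MeasurableSpace Ω] {P : ℕ∞ → Measure Ω}

lemma measurableSet_natCast_le {ℱ : Filtration ℕ mΩ} {τ : Ω → ℕ∞} (hτ : IsStoppingTime ℱ τ)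
    {m n : ℕ} (hmn : m ≤ n + 1) : MeasurableSet[ℱ n] {ω | (m : ℕ∞) ≤ τ ω} := by
  cases m with
  | zero => simp
  | succ j =>
    have h := ((hτ j).compl)
    have h2 : {ω | ((j + 1 : ℕ) : ℕ∞) ≤ τ ω} = {ω | τ ω ≤ (j : ℕ∞)}ᶜ := by
      ext ω
      simp only [Set.mem_ofPred_eq, Set.mem_compl_iff, not_le]
      push_cast
      exact ENat.add_one_le_iff (ENat.natCast_ne_top j)
    rw [h2]
    exact ℱ.mono (by omega) _ h

lemma measurableSet_eq_natCast {ℱ : Filtration ℕ mΩ} {τ : Ω → ℕ∞} (hτ : IsStoppingTime ℱ τ)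
    (n : ℕ) : MeasurableSet[ℱ n] {ω | τ ω = n} := by
  have h : {ω | τ ω = n} = {ω | (n : ℕ∞) ≤ τ ω} ∩ {ω | τ ω ≤ n} := by
    ext ω
    simp [le_antisymm_iff, and_comm]
  rw [h]
  exact (measurableSet_natCast_le hτ (by omega)).inter (hτ n)

lemma natCast_lt_add_one_sub_iff {a : ℕ∞} {ν t : ℕ} :
    (t : ℕ∞) < a + 1 - ν ↔ ((ν + t : ℕ) : ℕ∞) ≤ a := by
  induction a using ENat.recTopCoe with
  | top => simp
  | coe n => norm_cast; omega

lemma natCast_lt_iff_add_one_le {a : ℕ∞} {t : ℕ} :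
    (t : ℕ∞) < a ↔ ((t + 1 : ℕ) : ℕ∞) ≤ a := by
  push_cast
  exact (ENat.add_one_le_iff (ENat.natCast_ne_top t)).symm

lemma meanFalseAlarm_eq_tsum {ℱ : Filtration ℕ mΩ} {τ : Ω → ℕ∞} (hτ : IsStoppingTime ℱ τ) :
    meanFalseAlarm P τ = ∑' t : ℕ, P ⊤ {ω | ((t + 1 : ℕ) : ℕ∞) ≤ τ ω} := by
  have h := setLIntegral_toENNReal_eq_tsum (P ⊤) Set.univ τ fun t => by
    simp_rw [natCast_lt_iff_add_one_le]
    exact ℱ.le _ _ (measurableSet_natCast_le hτ le_rfl)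
  rw [setLIntegral_univ] at h
  simp only [Set.univ_inter, natCast_lt_iff_add_one_le] at h
  exact h

lemma measurableSet_natCast_lt_delay {ℱ : Filtration ℕ mΩ} {τ : Ω → ℕ∞}
    (hτ : IsStoppingTime ℱ τ) (ν t : ℕ) :
    MeasurableSet {ω | (t : ℕ∞) < τ ω + 1 - ν} := by
  simp_rw [natCast_lt_add_one_sub_iff]
  exact ℱ.le _ _ (measurableSet_natCast_le hτ (Nat.le_succ _))

/-- Pollak's delay is at most Lorden's, because `{ν ≤ τ}` is known before time `ν`. -/
lemma pollakDelay_le_lordenDelay {ℱ : Filtration ℕ mΩ} (hP : ∀ ν : ℕ, 1 ≤ ν →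
    IsProbabilityMeasure (P ν)) {τ : Ω → ℕ∞} (hτ : IsStoppingTime ℱ τ) :
    pollakDelay P τ ≤ lordenDelay ℱ P τ := by
  refine iSup₂_mono fun ν hν => ?_
  have := hP ν hν
  have hB : MeasurableSet[ℱ (ν - 1)] {ω | (ν : ℕ∞) ≤ τ ω} :=
    measurableSet_natCast_le hτ (by omega)
  rw [ProbabilityTheory.cond, lintegral_smul_measure, smul_eq_mul]
  have h := setLIntegral_le_of_essSup_condLExp (P := P ν) (ℱ.le (ν - 1))
    (fun ω => ((τ ω + 1 - (ν : ℕ∞) : ℕ∞) : ℝ≥0∞)) hB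
  rw [← ENNReal.div_eq_inv_mul]
  refine ENNReal.div_le_of_le_mul (le_trans (lintegral_mono fun ω => ?_) h)
  exact ENat.toENNReal_le.2 (tsub_le_tsub_right le_self_add _)

lemma measure_ne_top_eq_tsum (Q : Measure Ω) {ℱ : Filtration ℕ mΩ} {τ : Ω → ℕ∞}
    (hτ : IsStoppingTime ℱ τ) : Q {ω | τ ω ≠ ⊤} = ∑' n : ℕ, Q {ω | τ ω = n} := by
  rw [← measure_iUnion (disjoint_eq_natCast τ) fun n => ℱ.le _ _ (measurableSet_eq_natCast hτ n)]
  congr 1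
  ext ω
  simp only [Set.mem_ofPred_eq, Set.mem_iUnion, ENat.ne_top_iff_exists, eq_comm]

/-- A stopping time with mean at least `γ` under `P_∞` has, for some `ν`, conditional probability at
most `2m / γ` of falling in a window of length `m` that starts at `ν`. Otherwise the sum over `ν`
of the window probabilities, which is at most `m`, would be at least `(2m / γ) E_∞[τ] ≥ 2m`. -/
lemma exists_measure_window_le [IsProbabilityMeasure (P ⊤)] {ℱ : Filtration ℕ mΩ} {τ : Ω → ℕ∞}
    (hτ : IsStoppingTime ℱ τ) {γ : ℝ} (hγ : 0 < γ) (hE : ENNReal.ofReal γ ≤ meanFalseAlarm P τ)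
    {m : ℕ} (hm : 1 ≤ m) :
    ∃ ν : ℕ, 1 ≤ ν ∧ P ⊤ {ω | (ν : ℕ∞) ≤ τ ω} ≠ 0 ∧
      ∑ j ∈ Finset.range m, P ⊤ {ω | τ ω = (ν + j : ℕ)} ≤
        ENNReal.ofReal (2 * m / γ) * P ⊤ {ω | (ν : ℕ∞) ≤ τ ω} := by
  by_contra! hcon
  have h1 : ∀ t : ℕ, ENNReal.ofReal (2 * m / γ) * P ⊤ {ω | ((t + 1 : ℕ) : ℕ∞) ≤ τ ω} ≤
      ∑ j ∈ Finset.range m, P ⊤ {ω | τ ω = (t + 1 + j : ℕ)} := by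
    intro t
    by_cases h0 : P ⊤ {ω | ((t + 1 : ℕ) : ℕ∞) ≤ τ ω} = 0
    · rw [h0, mul_zero]
      exact zero_le
    · exact (hcon (t + 1) (Nat.succ_pos t) h0).le
  have h2 : ENNReal.ofReal (2 * m / γ) * meanFalseAlarm P τ ≤ m := by
    rw [meanFalseAlarm_eq_tsum hτ, ← ENNReal.tsum_mul_left]
    refine (ENNReal.tsum_le_tsum h1).trans ?_
    rw [Summable.tsum_finsetSum fun _ _ => ENNReal.summable]
    calc _ ≤ ∑ j ∈ Finset.range m, (1 : ℝ≥0∞) := by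
          refine Finset.sum_le_sum fun j _ => ?_
          calc ∑' t : ℕ, P ⊤ {ω | τ ω = (t + 1 + j : ℕ)} ≤ ∑' n : ℕ, P ⊤ {ω | τ ω = n} :=
                ENNReal.tsum_comp_le_tsum_of_injective (f := fun t : ℕ => t + 1 + j)
                  (fun a b hab => by simpa using hab) fun n : ℕ => P ⊤ {ω | τ ω = n}
            _ = P ⊤ {ω | τ ω ≠ ⊤} := (measure_ne_top_eq_tsum _ hτ).symm
            _ ≤ 1 := prob_le_one
      _ = m := by simp
  have h3 : (2 * m : ℝ≥0∞) ≤ m := by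
    refine le_trans ?_ ((mul_le_mul_right hE _).trans h2)
    rw [← ENNReal.ofReal_mul (by positivity), div_mul_cancel₀ _ hγ.ne']
    simp [ENNReal.ofReal_mul]
  have h4 : 2 * m ≤ m := by exact_mod_cast h3
  omega

end StoppingTime

/-! ### The modified CUSUM time -/

section Cusum

variable {Ω : Type*} {Z : ℕ → ℕ → Ω → EReal} {γ : ℝ} {ω : Ω}

lemma modifiedCusum_le_iff {n : ℕ} :
    modifiedCusum Z γ ω ≤ n ↔ ∃ j ∈ Finset.Icc 1 n, ∃ k ∈ Finset.Icc 1 j,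
      ((Real.log γ : ℝ) : EReal) ≤ ∑ i ∈ Finset.Icc k j, Z i k ω := by
  rw [← ENat.lt_add_one_iff (ENat.natCast_ne_top n), modifiedCusum]
  simp only [iInf_lt_iff, Finset.le_sup_iff (EReal.bot_lt_coe _), exists_prop, Finset.mem_Icc]
  norm_cast
  simp only [Nat.lt_succ_iff]
  constructor
  · rintro ⟨j, ⟨hj, h⟩, hjn⟩
    exact ⟨j, ⟨hj, hjn⟩, h⟩
  · rintro ⟨j, ⟨hj, hjn⟩, h⟩
    exact ⟨j, ⟨hj, h⟩, hjn⟩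

lemma sum_lt_of_lt_modifiedCusum {k n : ℕ} (hk : 1 ≤ k) (hkn : k ≤ n)
    (h : (n : ℕ∞) < modifiedCusum Z γ ω) :
    ∑ i ∈ Finset.Icc k n, Z i k ω < ((Real.log γ : ℝ) : EReal) := by
  by_contra! hle
  exact h.not_ge (modifiedCusum_le_iff.2 ⟨n, Finset.mem_Icc.2 ⟨hk.trans hkn, le_rfl⟩, k,
    Finset.mem_Icc.2 ⟨hk, hkn⟩, hle⟩)

lemma exists_log_le_sum_of_modifiedCusum_eq {n : ℕ} (h : modifiedCusum Z γ ω = n) :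
    ∃ k ∈ Finset.Icc 1 n, ((Real.log γ : ℝ) : EReal) ≤ ∑ i ∈ Finset.Icc k n, Z i k ω := by
  obtain ⟨j, hj, hk⟩ := modifiedCusum_le_iff.1 h.le
  have hjn : (n : ℕ∞) ≤ j := by
    rw [← h]
    exact modifiedCusum_le_iff.2 ⟨j, Finset.mem_Icc.2 ⟨(Finset.mem_Icc.1 hj).1, le_rfl⟩, hk⟩
  have hjn' : n ≤ j := by exact_mod_cast hjn
  obtain rfl : j = n := le_antisymm (Finset.mem_Icc.1 hj).2 hjn'
  exact hk

end Cusum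

section Model

variable {Ω 𝓧 : Type*} [MeasurableSpace 𝓧] {μ : Measure 𝓧} {f : CondDensities μ}
  {X : ℕ → Ω → 𝓧} [mΩ : MeasurableSpace Ω] {P : ℕ∞ → Measure Ω}

lemma isStoppingTime_modifiedCusum (f : CondDensities μ) (hX : ∀ n, Measurable (X n)) (γ : ℝ) :
    IsStoppingTime (obsFiltration X hX) (modifiedCusum (changeLLR f X) γ) := by
  intro n
  have h : {ω | modifiedCusum (changeLLR f X) γ ω ≤ (n : ℕ∞)} =
      ⋃ j ∈ Finset.Icc 1 n, ⋃ k ∈ Finset.Icc 1 j,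
        {ω | ((Real.log γ : ℝ) : EReal) ≤ ∑ i ∈ Finset.Icc k j, changeLLR f X i k ω} := by
    ext ω
    simp only [Set.mem_ofPred_eq, modifiedCusum_le_iff, Set.mem_iUnion, exists_prop]
  refine (congrArg (MeasurableSet[obsFiltration X hX n]) h).mpr ?_
  refine Finset.measurableSet_biUnion _ fun j hj => Finset.measurableSet_biUnion _ fun k hk => ?_
  exact measurableSet_le measurable_const
    (measurable_sum_changeLLR f hX (Finset.mem_Icc.1 hk).1 (Finset.mem_Icc.1 hj).2)

variable [SigmaFinite μ]

/-- The false-alarm inequality `γ P_∞(τ_mc < ∞) ≤ E_∞[τ_mc]`. On `{τ_mc = n}` some likelihood ratio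
exceeds `γ`, so `γ P_∞(τ_mc = n) ≤ ∑_{k ≤ n} P_k(τ_mc = n)`; the sum over `n` is at most
`∑_k P_k(τ_mc ≥ k) = ∑_k P_∞(τ_mc ≥ k)`. -/
lemma ofReal_mul_measure_modifiedCusum_ne_top_le (hP : IsChangePointFamily f X P)
    (hX : ∀ n, Measurable (X n)) {γ : ℝ} (hγ : 0 < γ) :
    ENNReal.ofReal γ * P ⊤ {ω | modifiedCusum (changeLLR f X) γ ω ≠ ⊤} ≤
      meanFalseAlarm P (modifiedCusum (changeLLR f X) γ) := by
  have hτ := isStoppingTime_modifiedCusum f hX γ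
  set τ := modifiedCusum (changeLLR f X) γ with hτdef
  rw [measure_ne_top_eq_tsum _ hτ, meanFalseAlarm_eq_tsum hτ, ← ENNReal.tsum_mul_left]
  have hn : ∀ n : ℕ, ENNReal.ofReal γ * P ⊤ {ω | τ ω = n} ≤
      ∑' k : ℕ, if k + 1 ≤ n then P ((k + 1 : ℕ) : ℕ∞) {ω | τ ω = n} else 0 := by
    intro n
    let C : ℕ → Set Ω := fun k => {ω | τ ω = n} ∩
      {ω | ((Real.log γ : ℝ) : EReal) ≤ ∑ i ∈ Finset.Icc (k + 1) n, changeLLR f X i (k + 1) ω}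
    have hC : ∀ k, MeasurableSet[obsFiltration X hX n] (C k) := fun k =>
      (measurableSet_eq_natCast hτ n).inter (measurableSet_le measurable_const
        (measurable_sum_changeLLR f hX (Nat.succ_pos k) le_rfl))
    have hsub : {ω | τ ω = n} ⊆ ⋃ k ∈ Finset.range n, C k := by
      intro ω hω
      obtain ⟨k, hk, hle⟩ := exists_log_le_sum_of_modifiedCusum_eq hω
      obtain ⟨hk1, hkn⟩ := Finset.mem_Icc.1 hk
      simp only [Set.mem_iUnion, Finset.mem_range]
      refine ⟨k - 1, by omega, hω, ?_⟩
      simpa only [Set.mem_ofPred_eq, Nat.sub_add_cancel hk1] using hle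
    calc ENNReal.ofReal γ * P ⊤ {ω | τ ω = n}
        ≤ ENNReal.ofReal γ * ∑ k ∈ Finset.range n, P ⊤ (C k) := by
          gcongr
          exact (measure_mono hsub).trans (measure_biUnion_finset_le _ _)
      _ = ∑ k ∈ Finset.range n, ENNReal.ofReal γ * P ⊤ (C k) := Finset.mul_sum _ _ _
      _ ≤ ∑ k ∈ Finset.range n,
          if k + 1 ≤ n then P ((k + 1 : ℕ) : ℕ∞) {ω | τ ω = n} else 0 := by
          refine Finset.sum_le_sum fun k hk => ?_
          rw [if_pos (Nat.succ_le_of_lt (Finset.mem_range.1 hk))]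
          refine (hP.mul_measure_top_le hX (Nat.succ_pos k) (hC k) fun ω hω => ?_).trans
            (measure_mono Set.inter_subset_left)
          rw [ENNReal.log_ofReal_of_pos hγ]
          exact hω.2
      _ ≤ _ := ENNReal.sum_le_tsum _
  refine (ENNReal.tsum_le_tsum hn).trans ?_
  rw [ENNReal.tsum_comm]
  refine ENNReal.tsum_le_tsum fun k => ?_
  rw [← hP.measure_eq_top hX (Nat.lt_succ_self k) (measurableSet_natCast_le hτ le_rfl)]
  calc ∑' n : ℕ, (if k + 1 ≤ n then P ((k + 1 : ℕ) : ℕ∞) {ω | τ ω = n} else 0)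
      ≤ ∑' n : ℕ, P ((k + 1 : ℕ) : ℕ∞) ({ω | τ ω = n} ∩ {ω | ((k + 1 : ℕ) : ℕ∞) ≤ τ ω}) := by
        refine ENNReal.tsum_le_tsum fun n => ?_
        split_ifs with h
        · refine measure_mono fun ω (hω : τ ω = n) => ⟨hω, ?_⟩
          change _ ≤ τ ω
          rw [hω]
          exact_mod_cast h
        · exact zero_le
    _ ≤ P ((k + 1 : ℕ) : ℕ∞) (⋃ n : ℕ, {ω | τ ω = n} ∩ {ω | ((k + 1 : ℕ) : ℕ∞) ≤ τ ω}) := by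
        refine tsum_meas_le_meas_iUnion_of_disjoint _ (fun n => ?_) fun i j hij =>
          ((disjoint_eq_natCast τ hij).mono Set.inter_subset_left Set.inter_subset_left)
        exact ((obsFiltration X hX).le _ _ (measurableSet_eq_natCast hτ n)).inter
          ((obsFiltration X hX).le _ _ (measurableSet_natCast_le hτ (le_refl (k + 1))))
    _ ≤ P ((k + 1 : ℕ) : ℕ∞) {ω | ((k + 1 : ℕ) : ℕ∞) ≤ τ ω} :=
        measure_mono (Set.iUnion_subset fun n => Set.inter_subset_right)

lemma ofReal_le_meanFalseAlarm_modifiedCusum (hP : IsChangePointFamily f X P)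
    (hX : ∀ n, Measurable (X n)) {γ : ℝ} (hγ : 0 < γ) :
    ENNReal.ofReal γ ≤ meanFalseAlarm P (modifiedCusum (changeLLR f X) γ) := by
  have := hP.isProbabilityMeasure hX (ν := ⊤) le_top
  have hτ := isStoppingTime_modifiedCusum f hX γ
  have h := ofReal_mul_measure_modifiedCusum_ne_top_le hP hX hγ
  by_cases h0 : P ⊤ {ω | modifiedCusum (changeLLR f X) γ ω = ⊤} = 0
  · have h1 : P ⊤ {ω | modifiedCusum (changeLLR f X) γ ω ≠ ⊤} = 1 := by
      rw [← measure_univ (μ := P ⊤)]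
      refine measure_congr (eventuallyEq_set.2 ?_)
      have h2 : ∀ᵐ ω ∂P ⊤, modifiedCusum (changeLLR f X) γ ω ≠ ⊤ := by
        rw [ae_iff]
        simpa using h0
      filter_upwards [h2] with ω hω
      simpa using hω
    rwa [h1, mul_one] at h
  · refine le_of_le_of_eq le_top (Eq.symm ?_)
    rw [meanFalseAlarm_eq_tsum hτ, ← top_le_iff, ← ENNReal.tsum_const_eq_top_of_ne_zero
      (α := ℕ) h0]
    refine ENNReal.tsum_le_tsum fun t => measure_mono fun ω (hω : _ = ⊤) => ?_
    change _ ≤ modifiedCusum (changeLLR f X) γ ω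
    rw [hω]
    exact le_top

/-! ### Upper bound for the delay of the modified CUSUM time -/

/-- Geometric tails: the time after `ν` is cut into blocks of length `n + 1`, and in each block the
sum of log-likelihood ratios started at its first point stays below the threshold with conditional
probability at most `ε`. -/
lemma measure_le_modifiedCusum_le_pow (hP : IsChangePointFamily f X P)
    (hX : ∀ n, Measurable (X n)) {γ : ℝ} {n ν : ℕ} (hν : 1 ≤ ν) {ε : ℝ≥0∞}
    (hε : ∀ k, ν ≤ k → essSupCondProb (obsFiltration X hX) (P ν) (k - 1)
      {ω | ∑ i ∈ Finset.Icc k (k + n), changeLLR f X i k ω < ((Real.log γ : ℝ) : EReal)} ≤ ε)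
    {B : Set Ω} (hB : MeasurableSet[obsFiltration X hX (ν - 1)] B) (m : ℕ) :
    P ν (B ∩ {ω | ((ν + m * (n + 1) : ℕ) : ℕ∞) ≤ modifiedCusum (changeLLR f X) γ ω}) ≤
      ε ^ m * P ν B := by
  have := hP.isProbabilityMeasure hX (ν := ν) (by exact_mod_cast hν)
  have hτ := isStoppingTime_modifiedCusum f hX γ
  induction m with
  | zero =>
    rw [pow_zero, one_mul]
    exact measure_mono Set.inter_subset_left
  | succ m ih =>
    set k := ν + m * (n + 1) with hk
    have hkn : ν + (m + 1) * (n + 1) = k + n + 1 := by rw [hk]; ring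
    have hmeas : MeasurableSet[obsFiltration X hX (k - 1)]
        (B ∩ {ω | (k : ℕ∞) ≤ modifiedCusum (changeLLR f X) γ ω}) :=
      ((obsFiltration X hX).mono (by omega) _ hB).inter
        (measurableSet_natCast_le hτ (by omega))
    have hA : MeasurableSet {ω | ∑ i ∈ Finset.Icc k (k + n), changeLLR f X i k ω <
        ((Real.log γ : ℝ) : EReal)} :=
      (obsFiltration X hX).le (k + n) _ (measurableSet_lt
        (measurable_sum_changeLLR f hX (by omega) le_rfl) measurable_const)
    calc _ ≤ P ν ((B ∩ {ω | (k : ℕ∞) ≤ modifiedCusum (changeLLR f X) γ ω}) ∩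
          {ω | ∑ i ∈ Finset.Icc k (k + n), changeLLR f X i k ω <
            ((Real.log γ : ℝ) : EReal)}) := by
          rw [hkn]
          refine measure_mono fun ω hω => ?_
          have h1 : ((k + n : ℕ) : ℕ∞) < modifiedCusum (changeLLR f X) γ ω :=
            natCast_lt_iff_add_one_le.2 hω.2
          have h2 : (k : ℕ∞) ≤ modifiedCusum (changeLLR f X) γ ω :=
            le_trans (by exact_mod_cast Nat.le_add_right k n) h1.le
          exact ⟨⟨hω.1, h2⟩, sum_lt_of_lt_modifiedCusum (by omega) (by omega) h1⟩
      _ ≤ ε * P ν (B ∩ {ω | (k : ℕ∞) ≤ modifiedCusum (changeLLR f X) γ ω}) := by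
          refine (measure_inter_le_of_essSup_condLExp ((obsFiltration X hX).le _) hA hmeas).trans ?_
          gcongr
          exact hε k (by omega)
      _ ≤ ε * (ε ^ m * P ν B) := by gcongr
      _ = ε ^ (m + 1) * P ν B := by rw [pow_succ']; ring

lemma lordenDelay_modifiedCusum_le (hP : IsChangePointFamily f X P)
    (hX : ∀ n, Measurable (X n)) {γ : ℝ} {n : ℕ} {ε : ℝ≥0∞}
    (hε : ∀ ν k : ℕ, 1 ≤ ν → ν ≤ k → essSupCondProb (obsFiltration X hX) (P ν) (k - 1)
      {ω | ∑ i ∈ Finset.Icc k (k + n), changeLLR f X i k ω < ((Real.log γ : ℝ) : EReal)} ≤ ε) :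
    lordenDelay (obsFiltration X hX) P (modifiedCusum (changeLLR f X) γ) ≤
      (n + 1 : ℕ) * (1 - ε)⁻¹ := by
  have hτ := isStoppingTime_modifiedCusum f hX γ
  refine iSup₂_le fun ν hν => ?_
  have := hP.isProbabilityMeasure hX (ν := ν) (by exact_mod_cast hν)
  refine essSup_condLExp_le ((obsFiltration X hX).le _) _ _ fun B hB => ?_
  rw [setLIntegral_toENNReal_eq_tsum _ _ _ (measurableSet_natCast_lt_delay hτ ν),
    ← ENNReal.tsum_geometric, ← ENNReal.tsum_comp_div (n + 1) (Nat.succ_pos n) (fun m => ε ^ m),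
    ← ENNReal.tsum_mul_right]
  refine ENNReal.tsum_le_tsum fun t => ?_
  refine le_trans (measure_mono (Set.inter_subset_inter_right _ fun ω hω => ?_))
    (measure_le_modifiedCusum_le_pow hP hX hν (fun k hk => hε ν k hν hk) hB (t / (n + 1)))
  refine le_trans ?_ (natCast_lt_add_one_sub_iff.1 hω)
  exact_mod_cast Nat.add_le_add_left (Nat.div_mul_le_self t (n + 1)) ν

/-! ### Lower bound for the delay of every feasible stopping time -/

/-- The quantitative lower bound. In the window of `exists_measure_window_le` the log-likelihood
ratio reaches `b` with conditional probability at most `ε`, and by change of measure `τ` stops below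
this level with conditional probability at most `exp b * (2m / γ)`. Otherwise the delay is at least
`m`. -/
lemma mul_le_pollakDelay (hP : IsChangePointFamily f X P) (hX : ∀ n, Measurable (X n))
    {τ : Ω → ℕ∞} {γ : ℝ} (hγ : 0 < γ) (hτ : τ ∈ feasible (obsFiltration X hX) P γ)
    {m : ℕ} (hm : 1 ≤ m) (b : ℝ) {ε : ℝ≥0∞}
    (hε : ∀ ν : ℕ, 1 ≤ ν → essSupCondProb (obsFiltration X hX) (P ν) (ν - 1)
      {ω | (b : EReal) ≤ (Finset.range (m + 1)).sup fun t =>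
        ∑ i ∈ Finset.Icc ν (ν + t), changeLLR f X i ν ω} ≤ ε) :
    (1 - (ENNReal.ofReal (Real.exp b) * ENNReal.ofReal (2 * m / γ) + ε)) * m ≤
      pollakDelay P τ := by
  have := hP.isProbabilityMeasure hX (ν := ⊤) le_top
  obtain ⟨hst, hE⟩ := hτ
  obtain ⟨ν, hν, hpos, hwin⟩ := exists_measure_window_le hst hγ hE hm
  have := hP.isProbabilityMeasure hX (ν := ν) (by exact_mod_cast hν)
  have hBm : MeasurableSet[obsFiltration X hX (ν - 1)] {ω | (ν : ℕ∞) ≤ τ ω} :=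
    measurableSet_natCast_le hst (by omega)
  have heq : P ν {ω | (ν : ℕ∞) ≤ τ ω} = P ⊤ {ω | (ν : ℕ∞) ≤ τ ω} :=
    hP.measure_eq_top hX (by omega) hBm
  set B : Set Ω := {ω | (ν : ℕ∞) ≤ τ ω} with hBdef
  rw [← heq] at hpos hwin
  have hB : MeasurableSet B := (obsFiltration X hX).le _ _ hBm
  let A : Set Ω := {ω | (b : EReal) ≤ (Finset.range (m + 1)).sup fun t =>
    ∑ i ∈ Finset.Icc ν (ν + t), changeLLR f X i ν ω}
  have hAiff : ∀ ω, ω ∈ A ↔ ∃ t ∈ Finset.range (m + 1),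
      (b : EReal) ≤ ∑ i ∈ Finset.Icc ν (ν + t), changeLLR f X i ν ω := fun ω =>
    Finset.le_sup_iff (EReal.bot_lt_coe _)
  have hsum : ∀ t, Measurable[obsFiltration X hX (ν + t)] fun ω =>
      ∑ i ∈ Finset.Icc ν (ν + t), changeLLR f X i ν ω := fun t =>
    measurable_sum_changeLLR f hX hν le_rfl
  have hA : MeasurableSet A := by
    have : A = ⋃ t ∈ Finset.range (m + 1),
        {ω | (b : EReal) ≤ ∑ i ∈ Finset.Icc ν (ν + t), changeLLR f X i ν ω} := by
      ext ω
      simp only [hAiff, Set.mem_iUnion, exists_prop, Set.mem_ofPred_eq]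
    rw [this]
    exact Finset.measurableSet_biUnion _ fun t _ => (obsFiltration X hX).le _ _
      (measurableSet_le measurable_const (hsum t))
  let D : ℕ → Set Ω := fun j => {ω | τ ω = (ν + j : ℕ)} ∩
    {ω | ∑ i ∈ Finset.Icc ν (ν + j), changeLLR f X i ν ω < (b : EReal)}
  let E : Set Ω := {ω | ((ν + m : ℕ) : ℕ∞) ≤ τ ω}
  -- Given `ν ≤ τ`, either `τ` is past the window, or the log-likelihood ratio reaches `b`, or `τ`
  -- stops in the window while the ratio is below `b`.
  have hcover : B ⊆ E ∪ ((B ∩ A) ∪ ⋃ j ∈ Finset.range m, D j) := by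
    intro ω hω
    by_cases hωE : ω ∈ E
    · exact Or.inl hωE
    refine Or.inr ?_
    by_cases hωA : ω ∈ A
    · exact Or.inl ⟨hω, hωA⟩
    refine Or.inr ?_
    have hlt : τ ω < (ν + m : ℕ) := not_le.1 hωE
    obtain ⟨n, hn⟩ := ENat.ne_top_iff_exists.1 (hlt.trans_le le_top).ne
    have hω' : (ν : ℕ∞) ≤ τ ω := hω
    rw [← hn] at hlt hω'
    have h1 : n < ν + m := by exact_mod_cast hlt
    have h2 : ν ≤ n := by exact_mod_cast hω'
    simp only [Set.mem_iUnion, Finset.mem_range]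
    refine ⟨n - ν, by omega, ?_, ?_⟩
    · change τ ω = _
      rw [← hn, Nat.add_sub_cancel' h2]
    · rw [hAiff] at hωA
      push Not at hωA
      exact hωA (n - ν) (Finset.mem_range.2 (by omega))
  have hD : ∑ j ∈ Finset.range m, P ν (D j) ≤
      ENNReal.ofReal (Real.exp b) * ENNReal.ofReal (2 * m / γ) * P ν B := by
    calc ∑ j ∈ Finset.range m, P ν (D j)
        ≤ ∑ j ∈ Finset.range m, ENNReal.ofReal (Real.exp b) * P ⊤ {ω | τ ω = (ν + j : ℕ)} := by
          refine Finset.sum_le_sum fun j _ => ?_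
          refine (hP.measure_le_mul_top hX hν (n := ν + j) (A := D j) (c := ENNReal.ofReal
            (Real.exp b)) ((measurableSet_eq_natCast hst _).inter
              (measurableSet_lt (hsum j) measurable_const)) ENNReal.ofReal_ne_top
              fun ω hω => ?_).trans ?_
          · rw [ENNReal.log_ofReal_of_pos (Real.exp_pos b), Real.log_exp]
            exact hω.2
          · gcongr
            exact Set.inter_subset_left
      _ ≤ ENNReal.ofReal (Real.exp b) * (ENNReal.ofReal (2 * m / γ) * P ν B) := by
          rw [← Finset.mul_sum]
          gcongr
      _ = _ := (mul_assoc _ _ _).symm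
  have hη : P ν B ≤ P ν E +
      (ENNReal.ofReal (Real.exp b) * ENNReal.ofReal (2 * m / γ) + ε) * P ν B := by
    calc P ν B ≤ P ν E + (P ν (B ∩ A) + ∑ j ∈ Finset.range m, P ν (D j)) := by
          refine (measure_mono hcover).trans ((measure_union_le _ _).trans ?_)
          gcongr
          refine (measure_union_le _ _).trans ?_
          gcongr
          exact measure_biUnion_finset_le _ _
      _ ≤ P ν E + (ε * P ν B +
          ENNReal.ofReal (Real.exp b) * ENNReal.ofReal (2 * m / γ) * P ν B) := by
          gcongr
          refine (measure_inter_le_of_essSup_condLExp ((obsFiltration X hX).le _) hA hBm).trans ?_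
          gcongr
          exact hε ν hν
      _ = _ := by ring
  generalize ENNReal.ofReal (Real.exp b) * ENNReal.ofReal (2 * m / γ) + ε = η at hη ⊢
  have hEB : (1 - η) * P ν B ≤ P ν E := by
    rw [ENNReal.sub_mul fun _ _ => measure_ne_top _ _, one_mul]
    exact tsub_le_iff_right.2 hη
  have hint : m * P ν E ≤ ∫⁻ ω in B, ((τ ω - (ν : ℕ∞) : ℕ∞) : ℝ≥0∞) ∂(P ν) := by
    have hEm : MeasurableSet E :=
      (obsFiltration X hX).le _ _ (measurableSet_natCast_le hst (Nat.le_succ _))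
    have hsub : E ⊆ B := fun ω (hω : _ ≤ τ ω) =>
      le_trans (by exact_mod_cast Nat.le_add_right ν m) hω
    rw [← setLIntegral_const]
    refine le_trans (setLIntegral_mono' hEm fun ω (hω : _ ≤ τ ω) => ?_)
      (lintegral_mono_set hsub)
    rw [← ENat.toENNReal_coe]
    refine ENat.toENNReal_le.2 ?_
    refine le_trans ?_ (tsub_le_tsub_right hω _)
    exact_mod_cast (Nat.add_sub_cancel_left (n := ν) (m := m)).ge
  refine le_trans ?_ (le_iSup₂ (f := fun (ν : ℕ) (_ : 1 ≤ ν) =>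
    ∫⁻ ω, ((τ ω - (ν : ℕ∞) : ℕ∞) : ℝ≥0∞) ∂((P ν)[|{ω | (ν : ℕ∞) ≤ τ ω}])) ν hν)
  simp only [ProbabilityTheory.cond]
  rw [lintegral_smul_measure, smul_eq_mul, ← ENNReal.div_eq_inv_mul,
    ENNReal.le_div_iff_mul_le (Or.inl hpos) (Or.inl (measure_ne_top _ _))]
  calc (1 - η) * m * P ν B = m * ((1 - η) * P ν B) := by ring
    _ ≤ m * P ν E := by gcongr
    _ ≤ _ := hint

end Model

/-! ### Asymptotics in the false-alarm level -/

/-- Upper bounds with every relative error `η > 0` combine into one with relative error `o(1)`. -/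
lemma exists_tendsto_zero_of_eventually_le {V : ℝ → ℝ≥0∞} {I : ℝ} (hI : 0 < I)
    (h : ∀ η : ℝ, 0 < η → ∀ᶠ γ : ℝ in atTop, V γ ≤ ENNReal.ofReal (Real.log γ / I * (1 + η))) :
    ∃ r : ℝ → ℝ, Tendsto r atTop (𝓝 0) ∧ ∀ᶠ γ : ℝ in atTop,
      V γ ≤ ENNReal.ofReal (Real.log γ / I * (1 + r γ)) := by
  have hlog : ∀ᶠ γ : ℝ in atTop, 0 < Real.log γ / I :=
    (Real.tendsto_log_atTop.atTop_div_const hI).eventually_gt_atTop 0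
  refine ⟨fun γ => max 0 ((V γ).toReal / (Real.log γ / I) - 1), ?_, ?_⟩
  · rw [Metric.tendsto_nhds]
    intro η hη
    filter_upwards [hlog, h (η / 2) (by positivity)] with γ hγ hV
    have h1 : (V γ).toReal ≤ Real.log γ / I * (1 + η / 2) :=
      ENNReal.toReal_le_of_le_ofReal (by positivity) hV
    have h2 : (V γ).toReal / (Real.log γ / I) ≤ 1 + η / 2 := by
      rw [div_le_iff₀ hγ]
      linarith
    rw [Real.dist_0_eq_abs, abs_of_nonneg (le_max_left _ _)]
    exact max_lt hη (by linarith)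
  · filter_upwards [hlog, h 1 one_pos] with γ hγ hV
    refine ENNReal.le_ofReal_iff_toReal_le (hV.trans_lt ENNReal.ofReal_lt_top).ne ?_ |>.2 ?_
    · positivity
    · have h1 := le_max_right 0 ((V γ).toReal / (Real.log γ / I) - 1)
      have h2 : (V γ).toReal / (Real.log γ / I) ≤
          1 + max 0 ((V γ).toReal / (Real.log γ / I) - 1) := by linarith
      rw [div_le_iff₀ hγ] at h2
      linarith

/-- Lower bounds with every relative error `η > 0` combine into one with relative error `o(1)`. -/
lemma exists_tendsto_zero_of_le_eventually {V : ℝ → ℝ≥0∞} {I : ℝ} (hI : 0 < I)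
    (h : ∀ η : ℝ, 0 < η → η < 1 →
      ∀ᶠ γ : ℝ in atTop, ENNReal.ofReal (Real.log γ / I * (1 - η)) ≤ V γ) :
    ∃ r : ℝ → ℝ, Tendsto r atTop (𝓝 0) ∧ ∀ᶠ γ : ℝ in atTop,
      ENNReal.ofReal (Real.log γ / I * (1 + r γ)) ≤ V γ := by
  have hlog : ∀ᶠ γ : ℝ in atTop, 0 < Real.log γ / I :=
    (Real.tendsto_log_atTop.atTop_div_const hI).eventually_gt_atTop 0
  -- `toReal` sends `∞` to `0`, so infinite values of `V` are treated separately.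
  refine ⟨fun γ => if V γ = ∞ then 0 else min 0 ((V γ).toReal / (Real.log γ / I) - 1), ?_, ?_⟩
  · rw [Metric.tendsto_nhds]
    intro η hη
    have hη' : 0 < min (η / 2) (1 / 2) := by positivity
    filter_upwards [hlog, h _ hη' (by linarith [min_le_right (η / 2) (1 / 2 : ℝ)])] with γ hγ hV
    split_ifs with htop
    · simpa using hη
    have h1 : Real.log γ / I * (1 - min (η / 2) (1 / 2)) ≤ (V γ).toReal :=
      (ENNReal.ofReal_le_iff_le_toReal htop).1 hV
    have h2 : 1 - min (η / 2) (1 / 2) ≤ (V γ).toReal / (Real.log γ / I) := by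
      rw [le_div_iff₀ hγ]
      linarith
    have h3 := min_le_left (η / 2) (1 / 2 : ℝ)
    rw [Real.dist_0_eq_abs, abs_of_nonpos (min_le_left _ _), neg_lt]
    exact lt_min (by linarith) (by linarith)
  · filter_upwards [hlog] with γ hγ
    split_ifs with htop
    · rw [htop]
      exact le_top
    rw [ENNReal.ofReal_le_iff_le_toReal htop]
    have h1 := min_le_right 0 ((V γ).toReal / (Real.log γ / I) - 1)
    have h2 : 1 + min 0 ((V γ).toReal / (Real.log γ / I) - 1) ≤
        (V γ).toReal / (Real.log γ / I) := by linarith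
    rw [le_div_iff₀ hγ] at h2
    linarith

section Model

variable {Ω 𝓧 : Type*} [MeasurableSpace 𝓧] {μ : Measure 𝓧} [SigmaFinite μ]
  {f : CondDensities μ} {X : ℕ → Ω → 𝓧} [mΩ : MeasurableSpace Ω] {P : ℕ∞ → Measure Ω}

lemma essSupCondProb_mono (ℱ : Filtration ℕ mΩ) (Q : Measure Ω) (m : ℕ) {A B : Set Ω}
    (h : A ⊆ B) : essSupCondProb ℱ Q m A ≤ essSupCondProb ℱ Q m B :=
  essSup_mono_ae (condLExp_mono (ae_of_all _ fun ω =>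
    Set.indicator_le_indicator_of_subset h (fun _ => zero_le) ω))

lemma eventually_lordenDelay_modifiedCusum_le (hP : IsChangePointFamily f X P)
    (hX : ∀ n, Measurable (X n)) {I : ℝ} (hI : 0 < I)
    (hdev : LowerDeviationCondition (obsFiltration X hX) P (changeLLR f X) I)
    {η : ℝ} (hη : 0 < η) :
    ∀ᶠ γ : ℝ in atTop, lordenDelay (obsFiltration X hX) P (modifiedCusum (changeLLR f X) γ) ≤
      ENNReal.ofReal (Real.log γ / I * (1 + η)) := by
  -- With deviation `δ = s I` and `ε = s`, the bound is about `(1 - s)⁻² log γ / I`, and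
  -- `(1 - s)⁻² ≤ 1 + 3 s ≤ 1 + η / 2`; the other `η / 2` absorbs the rounding of the block length.
  obtain ⟨s, hs0, hs1, hsη⟩ : ∃ s : ℝ, 0 < s ∧ 6 * s ≤ 1 ∧ 6 * s ≤ η :=
    ⟨min η 1 / 6, by positivity, by linarith [min_le_right η 1], by linarith [min_le_left η 1]⟩
  have hL : Tendsto (fun γ : ℝ => Real.log γ / I) atTop atTop :=
    Real.tendsto_log_atTop.atTop_div_const hI
  have hn : Tendsto (fun γ : ℝ => ⌈Real.log γ / I / (1 - s)⌉₊) atTop atTop :=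
    tendsto_nat_ceil_atTop.comp (hL.atTop_div_const (by linarith))
  have hε := (hdev (s * I) (by positivity)).eventually
    (Iic_mem_nhds (ENNReal.ofReal_pos.2 hs0))
  filter_upwards [hn.eventually hε, hn.eventually_ge_atTop 1, hL.eventually_ge_atTop (1 / s),
    hL.eventually_gt_atTop 0] with γ hγε hn1 hLs hL0
  set n := ⌈Real.log γ / I / (1 - s)⌉₊ with hndef
  set l := Real.log γ / I with hl
  have hlog : Real.log γ = l * I := (div_mul_cancel₀ _ hI.ne').symm
  have hln : l ≤ n * (1 - s) := by
    rw [← div_le_iff₀ (by linarith)]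
    exact Nat.le_ceil _
  have hnl : (n : ℝ) < l / (1 - s) + 1 :=
    Nat.ceil_lt_add_one (div_nonneg hL0.le (by linarith))
  have hbound := lordenDelay_modifiedCusum_le hP hX (γ := γ) (n := n) (ε := ENNReal.ofReal s)
    fun ν k hν hk => by
      refine le_trans (essSupCondProb_mono _ _ _ fun ω hω => ?_)
        (iSup₂_le_iff.1 (iSup₂_le_iff.1 hγε ν hν) k hk)
      change (∑ i ∈ Finset.Icc k (k + n), changeLLR f X i k ω) / (n : EReal) ≤ _
      have hn0 : (0 : EReal) < n := by exact_mod_cast hn1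
      rw [EReal.div_le_iff_le_mul hn0 (EReal.natCast_ne_top n)]
      refine le_trans (le_of_lt hω) ?_
      have h1 : Real.log γ ≤ n * (I - s * I) := by
        rw [hlog]
        nlinarith
      exact_mod_cast h1
  refine hbound.trans ?_
  rw [← ENNReal.ofReal_one, ← ENNReal.ofReal_sub _ hs0.le, ← ENNReal.ofReal_inv_of_pos
    (by linarith), ← ENNReal.ofReal_natCast, ← ENNReal.ofReal_mul (by positivity)]
  refine ENNReal.ofReal_le_ofReal ?_
  have h1s : 0 < 1 - s := by linarith
  rw [← div_eq_mul_inv, div_le_iff₀ h1s]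
  push_cast
  have h3 : l / (1 - s) ≤ l * (1 + 3 * s) * (1 - s) := by
    rw [div_le_iff₀ h1s, mul_assoc, mul_assoc]
    refine le_mul_of_one_le_right hL0.le ?_
    nlinarith [mul_nonneg hs0.le hs0.le, mul_nonneg hs0.le (sub_nonneg.2 hs1)]
  have h4 : 1 ≤ l * s := by rwa [div_le_iff₀ hs0] at hLs
  have h5 : l * s * 6 * (1 - s) ≤ l * η * (1 - s) := by
    have : l * (6 * s) ≤ l * η := mul_le_mul_of_nonneg_left hsη hL0.le
    nlinarith
  nlinarith [mul_nonneg (sub_nonneg.2 h4) h1s.le]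

lemma eventually_le_pollakDelay (hP : IsChangePointFamily f X P)
    (hX : ∀ n, Measurable (X n)) {I : ℝ} (hI : 0 < I)
    (hdev : UpperDeviationCondition (obsFiltration X hX) P (changeLLR f X) I)
    {η : ℝ} (hη : 0 < η) (hη1 : η < 1) :
    ∀ᶠ γ : ℝ in atTop, ENNReal.ofReal (Real.log γ / I * (1 - η)) ≤
      ⨅ τ ∈ feasible (obsFiltration X hX) P γ, pollakDelay P τ := by
  -- The bound is `(1 - s) m` with `m = ⌊(1 - s) log γ / I⌋`; the other `2 s` absorbs the rounding.
  obtain ⟨s, rfl⟩ : ∃ s : ℝ, 4 * s = η := ⟨η / 4, by ring⟩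
  have hs0 : 0 < s := by linarith
  have hs1 : s < 1 / 4 := by linarith
  have hL : Tendsto (fun γ : ℝ => Real.log γ / I) atTop atTop :=
    Real.tendsto_log_atTop.atTop_div_const hI
  have hm : Tendsto (fun γ : ℝ => ⌊(1 - s) * (Real.log γ / I)⌋₊) atTop atTop :=
    tendsto_nat_floor_atTop.comp (hL.const_mul_atTop (by linarith))
  have hε := (hdev s hs0).eventually (Iic_mem_nhds (ENNReal.ofReal_pos.2 (half_pos hs0)))
  have hexp : Tendsto (fun γ : ℝ => 2 / I * (Real.log γ * Real.exp (-(s ^ 2) * Real.log γ)))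
      atTop (𝓝 0) := by
    have h := tendsto_rpow_mul_exp_neg_mul_atTop_nhds_zero 1 (s ^ 2) (by positivity)
    simp only [Real.rpow_one] at h
    simpa using (h.comp Real.tendsto_log_atTop).const_mul (2 / I)
  filter_upwards [hm.eventually hε, hm.eventually_ge_atTop 1, hL.eventually_ge_atTop (1 / (2 * s)),
    hL.eventually_gt_atTop 0, eventually_gt_atTop 0,
    hexp.eventually (Iic_mem_nhds (half_pos hs0))] with γ hγε hm1 hLs hL0 hγ hγexp
  refine le_iInf₂ fun τ hτ => ?_
  set m := ⌊(1 - s) * (Real.log γ / I)⌋₊ with hmdef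
  set l := Real.log γ / I with hl
  have hlog : Real.log γ = l * I := (div_mul_cancel₀ _ hI.ne').symm
  have hml : (m : ℝ) ≤ (1 - s) * l := Nat.floor_le (mul_nonneg (by linarith) hL0.le)
  have hlm : (1 - s) * l < m + 1 := Nat.lt_floor_add_one _
  have hbound := mul_le_pollakDelay hP hX hγ hτ hm1 (I * (1 + s) * m)
    (ε := ENNReal.ofReal (s / 2)) (iSup₂_le_iff.1 hγε)
  refine le_trans ?_ hbound
  -- `exp b ≤ γ ^ (1 - s ^ 2)` for the level `b = I (1 + s) m`.
  have hcm : Real.exp (I * (1 + s) * m) * (2 * m / γ) ≤ s / 2 := by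
    refine le_trans ?_ hγexp
    have h1 : I * (1 + s) * m ≤ (1 - s ^ 2) * Real.log γ := by
      calc I * (1 + s) * m ≤ I * (1 + s) * ((1 - s) * l) := by gcongr
        _ = (1 - s ^ 2) * Real.log γ := by rw [hlog]; ring
    have h2 : (m : ℝ) ≤ l := by nlinarith
    calc Real.exp (I * (1 + s) * m) * (2 * m / γ)
        ≤ Real.exp ((1 - s ^ 2) * Real.log γ) * (2 * l / γ) := by gcongr
      _ = Real.exp ((1 - s ^ 2) * Real.log γ) * (2 * l * Real.exp (-Real.log γ)) := by
          rw [Real.exp_neg, Real.exp_log hγ, div_eq_mul_inv]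
      _ = 2 * l * Real.exp ((1 - s ^ 2) * Real.log γ + -Real.log γ) := by
          rw [Real.exp_add]; ring
      _ = 2 / I * (Real.log γ * Real.exp (-(s ^ 2) * Real.log γ)) := by
          rw [hl]
          ring_nf
  have hη : ENNReal.ofReal (Real.exp (I * (1 + s) * m)) * ENNReal.ofReal (2 * m / γ) +
      ENNReal.ofReal (s / 2) ≤ ENNReal.ofReal s := by
    rw [← ENNReal.ofReal_mul (Real.exp_pos _).le, ← ENNReal.ofReal_add (by positivity)
      (by positivity)]
    exact ENNReal.ofReal_le_ofReal (by linarith)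
  calc ENNReal.ofReal (l * (1 - 4 * s)) ≤ ENNReal.ofReal ((1 - s) * m) := by
        refine ENNReal.ofReal_le_ofReal ?_
        have h3 : 1 ≤ l * (2 * s) := by
          rwa [div_le_iff₀ (by linarith)] at hLs
        nlinarith [mul_nonneg hs0.le hL0.le, mul_nonneg hs0.le (mul_nonneg hs0.le hL0.le)]
    _ = (1 - ENNReal.ofReal s) * m := by
        rw [ENNReal.ofReal_mul (by linarith), ENNReal.ofReal_sub _ hs0.le, ENNReal.ofReal_one,
          ENNReal.ofReal_natCast]
    _ ≤ _ := by gcongr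

end Model

theorem mainTheorem2 {Ω 𝓧 : Type*} [MeasurableSpace Ω] [MeasurableSpace 𝓧]
    (μ : Measure 𝓧) [SigmaFinite μ] (f : CondDensities μ)
    (X : ℕ → Ω → 𝓧) (hX : ∀ n, Measurable (X n))
    (P : ℕ∞ → Measure Ω) (hP : IsChangePointFamily f X P)
    (I : ℝ) (hI : 0 < I) :
    -- (1) universal lower bound
    (UpperDeviationCondition (obsFiltration X hX) P (changeLLR f X) I →
      (∀ γ : ℝ,
        (⨅ τ ∈ feasible (obsFiltration X hX) P γ, pollakDelay P τ) ≤
          (⨅ τ ∈ feasible (obsFiltration X hX) P γ, lordenDelay (obsFiltration X hX) P τ)) ∧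
      ∃ r : ℝ → ℝ, Tendsto r atTop (𝓝 0) ∧ ∀ᶠ γ : ℝ in atTop,
        ENNReal.ofReal (Real.log γ / I * (1 + r γ)) ≤
          (⨅ τ ∈ feasible (obsFiltration X hX) P γ, pollakDelay P τ)) ∧
    -- (2) false alarms of the modified generalized CUSUM time
    (∀ γ : ℝ, 0 < γ →
      IsStoppingTime (obsFiltration X hX) (modifiedCusum (changeLLR f X) γ) ∧
      ENNReal.ofReal γ ≤ meanFalseAlarm P (modifiedCusum (changeLLR f X) γ)) ∧
    -- (3) the modified generalized CUSUM time achieves the lower bound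
    (LowerDeviationCondition (obsFiltration X hX) P (changeLLR f X) I →
      (∀ γ : ℝ, pollakDelay P (modifiedCusum (changeLLR f X) γ) ≤
        lordenDelay (obsFiltration X hX) P (modifiedCusum (changeLLR f X) γ)) ∧
      ∃ r : ℝ → ℝ, Tendsto r atTop (𝓝 0) ∧ ∀ᶠ γ : ℝ in atTop,
        lordenDelay (obsFiltration X hX) P (modifiedCusum (changeLLR f X) γ) ≤
          ENNReal.ofReal (Real.log γ / I * (1 + r γ))) := by
  have hprob : ∀ ν : ℕ, 1 ≤ ν → IsProbabilityMeasure (P ν) := fun ν hν =>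
    hP.isProbabilityMeasure hX (by exact_mod_cast hν)
  refine ⟨fun hdev => ⟨fun γ => ?_, ?_⟩, fun γ hγ => ⟨?_, ?_⟩, fun hdev => ⟨fun γ => ?_, ?_⟩⟩
  · exact iInf₂_mono fun τ hτ => pollakDelay_le_lordenDelay hprob hτ.1
  · exact exists_tendsto_zero_of_le_eventually hI fun η hη hη1 =>
      eventually_le_pollakDelay hP hX hI hdev hη hη1
  · exact isStoppingTime_modifiedCusum f hX γ
  · exact ofReal_le_meanFalseAlarm_modifiedCusum hP hX hγ
  · exact pollakDelay_le_lordenDelay hprob (isStoppingTime_modifiedCusum f hX γ)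
  · exact exists_tendsto_zero_of_eventually_le hI fun η hη =>
      eventually_lordenDelay_modifiedCusum_le hP hX hI hdev hη
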